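/- Fix an infinite set of symbols. A \emph{class of languages} is a set $\mathcal C$ of languages (sets of words), each of them contained in $\Sigma^*$ for some finite set $\Sigma$ of symbols; a language $L\subseteq\Sigma^*$ is regarded as a language over every finite alphabet containing $\Sigma$ as well. A \emph{monadic rewriting system} over a finite alphabet $\Sigma$ is a subset $\Gamma\subseteq\Sigma^*\times(\Sigma\cup\{\varepsilon\})$; it is a \emph{$\mathcal C$-monadic rewriting system} if $\Gamma_x=\{w\in\Sigma^*\mid (w,x)\in\Gamma\}$ belongs to $\mathcal C$ for every $x\in\Sigma\cup\{\varepsilon\}$. Write $rws\Rightarrow rxs$ whenever $(w,x)\in\Gamma$ and $r,s\in\Sigma^*$; the set of ancestors of $\{\varepsilon\}$ under $\Gamma$ is the set of all $u\in\Sigma^*$ with $u\Rightarrow^*\varepsilon$. A finitely generated group $G$ \emph{has word problem in $\mathcal C$} if, for some finite alphabet $A$ and some map $A\to G$ whose image generates $G$ as a monoid, the set of words in $A^*$ representing the identity of $G$ belongs to $\mathcal C$ (for $\mathcal C$ closed under inverse morphism, it is equivalent to require this for all such $A$). A \emph{finite graph of groups} $(G,Y)$ consists of finite sets $V$ (vertices)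 and $E$ (oriented edges), maps $\alpha,\omega:E\to V$ (start and end), a fixed-point-free involution $y\mapsto\overline y$ of $E$ with $\overline y\omega=y\alpha$, groups $G_v$ ($v\in V$) and $G_y=G_{\overline y}$ ($y\in E$), and injective morphisms $\alpha_y:G_y\to G_{y\alpha}$, $\omega_y:G_y\to G_{y\omega}$ with $\alpha_y=\omega_{\overline y}$. Let $F(G,Y)$ be the group generated by all the vertex groups and by $E$, subject to the relations of the vertex groups, $y\overline y=1$, and $y(g\omega_y)\overline y=g\alpha_y$ ($y\in E$, $g\in G_y$). For $v_0\in V$, the \emph{fundamental group} $\pi_1(G,Y,v_0)$ is the subgroup of $F(G,Y)$ of all elements $g_0y_1g_1\cdots y_ng_n$, where $y_1\cdots y_n$ is a path in $Y$ from $v_0$ to $v_0$, $g_0\in G_{v_0}$ and $g_i\in G_{y_i\omega}$ for $1\le i\le n$. \textbf{Theorem.} Let $\mathcal C$ be a class of languages that is closed under inverse morphism (if $L\in\mathcal C$, $L\subseteq\Delta^*$, and $f:\Sigma^*\to\Delta^*$ is a morphism with $\Sigma,\Delta$ finite, then $f^{-1}(L)\in\mathcal C$), closed under left and right translation ($L\mapsto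 wL$ and $L\mapsto Lw$ for every word $w$), and closed under taking the ancestors of $\{\varepsilon\}$ for any $\mathcal C$-monadic rewriting system. Let $(G,Y)$ be a finite graph of groups with finitely generated vertex groups and finite edge groups, and let $v_0$ be a vertex of $Y$. (1) If all vertex groups have word problem in $\mathcal C$, then $\pi_1(G,Y,v_0)$ is finitely generated and has word problem in $\mathcal C$. (2) If moreover $\mathcal C$ is closed under intersection with regular languages, $Y$ is connected, and $\pi_1(G,Y,v_0)$ is finitely generated and has word problem in $\mathcal C$, then every vertex group has word problem in $\mathcal C$. -/

import Mathlib

universe u₁ u₂ u₃ u₄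

/-! ## Classes of languages

Letters are taken from a fixed infinite set `S` of symbols.  A language over a finite alphabet
`A ⊆ S` is a set of words all of whose letters lie in `A`; it is at the same time a language over
every finite alphabet containing `A`. -/

/-- `A*`: the words all of whose letters lie in the alphabet `A`. -/
def wordsOver {S : Type u₁} (A : Finset S) : Language S :=
  {w : List S | ∀ a ∈ w, a ∈ A}

/-- A class (family) of languages over the symbol set `S`: a set of languages, each of them over
some finite alphabet. -/
structure LanguageClass (S : Type u₁) where
  carrier : Set (Language S)
  finite_alphabet : ∀ L ∈ carrier, ∃ A : Finset S, L ≤ wordsOver A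

/-- The inverse image of `L` under the morphism `A* → S*` which sends each letter `a ∈ A`
to the word `f a`. -/
def inverseMorphicImage {S : Type u₁} (A : Finset S) (f : S → List S) (L : Language S) :
    Language S :=
  {w : List S | w ∈ wordsOver A ∧ w.flatMap f ∈ L}

/-- A monadic rewriting system over the finite alphabet `A`: a subset of `A* × (A ∪ {ε})`.
The empty word on the right-hand side is represented by `none`. -/
structure MonadicSystem {S : Type u₁} (A : Finset S) where
  rules : Set (List S × Option S)
  lhs_mem : ∀ w x, (w, x) ∈ rules → w ∈ wordsOver A
  rhs_mem : ∀ w a, (w, some a) ∈ rules → a ∈ A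

namespace MonadicSystem

variable {S : Type u₁} {A : Finset S}

/-- `Γ_x`, the set of all words `w` for which `w → x` is a rule of `Γ`. -/
def lhs (Γ : MonadicSystem A) (x : Option S) : Language S :=
  {w : List S | (w, x) ∈ Γ.rules}

/-- The one-step rewriting relation `r w s ⇒ r x s`, for a rule `w → x`. -/
def Step (Γ : MonadicSystem A) (u v : List S) : Prop :=
  ∃ (r s w : List S) (x : Option S),
    (w, x) ∈ Γ.rules ∧ u = r ++ w ++ s ∧ v = r ++ x.toList ++ s

/-- The set `L Γ⁻¹` of all ancestors in `A*` of words of `L`. -/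
def ancestors (Γ : MonadicSystem A) (L : Language S) : Language S :=
  {u : List S | u ∈ wordsOver A ∧ ∃ v ∈ L, Relation.ReflTransGen Γ.Step u v}

/-- `Γ` is a `C`-monadic rewriting system. -/
def IsMonadicFor (Γ : MonadicSystem A) (C : LanguageClass S) : Prop :=
  Γ.lhs none ∈ C.carrier ∧ ∀ a ∈ A, Γ.lhs (some a) ∈ C.carrier

end MonadicSystem

namespace LanguageClass

variable {S : Type u₁}

def ClosedUnderInverseMorphism (C : LanguageClass S) : Prop :=
  ∀ (A : Finset S) (f : S → List S), ∀ L ∈ C.carrier, inverseMorphicImage A f L ∈ C.carrier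

/-- Closure under `L ↦ w L`. -/
def ClosedUnderLeftTranslation (C : LanguageClass S) : Prop :=
  ∀ (w : List S), ∀ L ∈ C.carrier, ({u : List S | ∃ x ∈ L, u = w ++ x} : Language S) ∈ C.carrier

/-- Closure under `L ↦ L w`. -/
def ClosedUnderRightTranslation (C : LanguageClass S) : Prop :=
  ∀ (w : List S), ∀ L ∈ C.carrier, ({u : List S | ∃ x ∈ L, u = x ++ w} : Language S) ∈ C.carrier

/-- Closure under taking the ancestors of `{ε}` for `C`-monadic rewriting systems. -/
def ClosedUnderAncestorsOfEmptyWord (C : LanguageClass S) : Prop :=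
  ∀ (A : Finset S) (Γ : MonadicSystem A), Γ.IsMonadicFor C →
    Γ.ancestors ({[]} : Set (List S)) ∈ C.carrier

/-- Closure under intersection with regular languages (over finite alphabets). -/
def ClosedUnderRegularIntersection (C : LanguageClass S) : Prop :=
  ∀ L ∈ C.carrier, ∀ R : Language S, R.IsRegular → (∃ A : Finset S, R ≤ wordsOver A) →
    L ⊓ R ∈ C.carrier

end LanguageClass

/-! ## Word problems -/

/-- The letters of the finite alphabet `A`, where `a` stands for `σ a`, generate `G` as a monoid. -/
def IsGenerating {S : Type u₁} {G : Type u₂} [Group G] (A : Finset S) (σ : S → G) : Prop :=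
  Submonoid.closure (σ '' (A : Set S)) = ⊤

/-- The set of all words over `A` which represent the identity of `G`. -/
def wordProblem {S : Type u₁} {G : Type u₂} [Group G] (A : Finset S) (σ : S → G) : Language S :=
  {w : List S | w ∈ wordsOver A ∧ (w.map σ).prod = 1}

/-- `G` is finitely generated and its word problem, with respect to some finite monoid generating
set, lies in `C`.  For `C` closed under inverse morphism the choice of the generating set does not
matter, see `HasWordProblemIn.wordProblem_mem`. -/
def HasWordProblemIn {S : Type u₁} (C : LanguageClass S) (G : Type u₂) [Group G] : Prop :=
  ∃ (A : Finset S) (σ : S → G), IsGenerating A σ ∧ wordProblem A σ ∈ C.carrier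

theorem IsGenerating.exists_word {S : Type u₁} {G : Type u₂} [Group G] {A : Finset S} {σ : S → G}
    (h : IsGenerating A σ) (g : G) : ∃ w ∈ wordsOver A, (w.map σ).prod = g := by
  have hg : g ∈ Submonoid.closure (σ '' (A : Set S)) := by
    rw [show Submonoid.closure (σ '' (A : Set S)) = ⊤ from h]; trivial
  induction hg using Submonoid.closure_induction with
  | mem x hx =>
    obtain ⟨a, ha, rfl⟩ := hx
    refine ⟨[a], ?_, by simp⟩
    intro b hb
    rw [List.mem_singleton] at hb
    subst hb
    exact ha
  | one => exact ⟨[], fun b hb => absurd hb List.not_mem_nil, by simp⟩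
  | mul x y _ _ hx hy =>
    obtain ⟨w, hw, rfl⟩ := hx
    obtain ⟨w', hw', rfl⟩ := hy
    refine ⟨w ++ w', ?_, by simp⟩
    intro b hb
    rcases List.mem_append.1 hb with hb | hb
    · exact hw b hb
    · exact hw' b hb

theorem HasWordProblemIn.wordProblem_mem {S : Type u₁} {C : LanguageClass S}
    (hC : C.ClosedUnderInverseMorphism) {G : Type u₂} [Group G] (h : HasWordProblemIn C G)
    (A : Finset S) (σ : S → G) : wordProblem A σ ∈ C.carrier := by
  obtain ⟨A', σ', hgen, hmem⟩ := h
  choose f hf hf' using fun a => hgen.exists_word (σ a)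
  have key : ∀ w : List S, ((w.flatMap f).map σ').prod = (w.map σ).prod := by
    intro w
    induction w with
    | nil => simp
    | cons a w ih => simp [List.flatMap_cons, ih, hf']
  have hover : ∀ w : List S, w.flatMap f ∈ wordsOver A' := by
    intro w b hb
    obtain ⟨a, _, hb⟩ := List.mem_flatMap.1 hb
    exact hf a b hb
  have := hC A f _ hmem
  have heq : inverseMorphicImage A f (wordProblem A' σ') = wordProblem A σ := by
    ext w
    constructor
    · rintro ⟨h1, -, h2⟩
      exact ⟨h1, (key w).symm.trans h2⟩
    · rintro ⟨h1, h2⟩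
      exact ⟨h1, hover w, (key w).trans h2⟩
  rwa [heq] at this

/-! ## Graphs of groups -/

/-- A graph of groups with vertex set `V` and set of oriented edges `E`.  The end of an edge `y` is
the start of `inv y`, and `edgeEquiv` is the identification of the groups `G_y` and `G_{inv y}`;
the second embedding `ω_y` is `α_{inv y}` under this identification. -/
structure GraphOfGroups (V : Type u₁) (E : Type u₂) where
  src : E → V
  inv : E → E
  inv_inv : ∀ y, inv (inv y) = y
  inv_ne : ∀ y, inv y ≠ y
  vertexGroup : V → Type u₃
  [vertexGroupInst : ∀ v, Group (vertexGroup v)]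
  edgeGroup : E → Type u₄
  [edgeGroupInst : ∀ y, Group (edgeGroup y)]
  edgeEquiv : ∀ y, edgeGroup y ≃* edgeGroup (inv y)
  edgeEquiv_edgeEquiv : ∀ y (g : edgeGroup y),
    (⟨inv (inv y), edgeEquiv (inv y) (edgeEquiv y g)⟩ : Σ z, edgeGroup z) = ⟨y, g⟩
  α : ∀ y, edgeGroup y →* vertexGroup (src y)
  α_injective : ∀ y, Function.Injective (α y)

namespace GraphOfGroups

attribute [instance] vertexGroupInst edgeGroupInst

variable {V : Type u₁} {E : Type u₂} (Y : GraphOfGroups.{u₁, u₂, u₃, u₄} V E)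

/-- The end of an edge. -/
def tgt (y : E) : V := Y.src (Y.inv y)

/-- The embedding of the edge group in the vertex group at the end of the edge. -/
def ω (y : E) : Y.edgeGroup y →* Y.vertexGroup (Y.tgt y) :=
  (Y.α (Y.inv y)).comp (Y.edgeEquiv y).toMonoidHom

theorem ω_injective (y : E) : Function.Injective (Y.ω y) :=
  (Y.α_injective (Y.inv y)).comp (Y.edgeEquiv y).injective

/-- The start of `y` is the end of `inv y`. -/
theorem tgt_inv (y : E) : Y.tgt (Y.inv y) = Y.src y := congrArg Y.src (Y.inv_inv y)

/-- `α_y` and `ω_{inv y}` agree. -/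
theorem ω_inv (y : E) (g : Y.edgeGroup y) :
    (⟨Y.tgt (Y.inv y), Y.ω (Y.inv y) (Y.edgeEquiv y g)⟩ : Σ v, Y.vertexGroup v) =
      ⟨Y.src y, Y.α y g⟩ :=
  congrArg (fun p : Σ z, Y.edgeGroup z => (⟨Y.src p.1, Y.α p.1 p.2⟩ : Σ v, Y.vertexGroup v))
    (Y.edgeEquiv_edgeEquiv y g)

/-- Any two vertices are joined by a path. -/
def Connected : Prop :=
  ∀ u v : V, Relation.ReflTransGen (fun a b => ∃ y, Y.src y = a ∧ Y.tgt y = b) u v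

/-- The generating set `B` of `F(G, Y)`: all elements of all vertex groups, and all edges. -/
abbrev Gen : Type (max u₁ u₂ u₃) := (Σ v, Y.vertexGroup v) ⊕ E

/-- The letter of `B` given by an element of a vertex group. -/
def vertexLetter {v : V} (g : Y.vertexGroup v) : Y.Gen := Sum.inl ⟨v, g⟩

/-- The letter of `B` given by an edge. -/
def edgeLetter (y : E) : Y.Gen := Sum.inr y

/-- The defining relations of `F(G, Y)`: the multiplication tables of the vertex groups,
`y ȳ = 1`, and `y (g ω_y) ȳ = g α_y`. -/
inductive Rel : FreeGroup Y.Gen → Prop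
  | mul (v : V) (g h : Y.vertexGroup v) :
      Rel (FreeGroup.of (Y.vertexLetter g) * FreeGroup.of (Y.vertexLetter h) *
        (FreeGroup.of (Y.vertexLetter (g * h)))⁻¹)
  | inv (y : E) :
      Rel (FreeGroup.of (Y.edgeLetter y) * FreeGroup.of (Y.edgeLetter (Y.inv y)))
  | edge (y : E) (g : Y.edgeGroup y) :
      Rel (FreeGroup.of (Y.edgeLetter y) * FreeGroup.of (Y.vertexLetter (Y.ω y g)) *
        FreeGroup.of (Y.edgeLetter (Y.inv y)) * (FreeGroup.of (Y.vertexLetter (Y.α y g)))⁻¹)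

/-- The group `F(G, Y)`. -/
abbrev F : Type (max u₁ u₂ u₃) := PresentedGroup {r : FreeGroup Y.Gen | Y.Rel r}

/-- The element of `F(G, Y)` represented by a word over `B`. -/
def eval (w : List Y.Gen) : Y.F :=
  (w.map fun b => (PresentedGroup.of b : Y.F)).prod

/-- `IsPathWord u v w`: the word `w` has the form `w₀ y₁ w₁ y₂ w₂ … yₙ wₙ`, where `y₁ … yₙ` is a
path from `u` to `v`, `w₀` is a word over `G_u`, and each `wᵢ` is a word over the vertex group at
the end of `yᵢ`.  The words of cycle type at `v` are those with `IsPathWord v v w`. -/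
inductive IsPathWord : V → V → List Y.Gen → Prop
  | nil (v : V) : IsPathWord v v []
  | vertex {u v : V} (g : Y.vertexGroup u) {w : List Y.Gen} :
      IsPathWord u v w → IsPathWord u v (Y.vertexLetter g :: w)
  | edge (y : E) {v : V} {w : List Y.Gen} :
      IsPathWord (Y.tgt y) v w → IsPathWord (Y.src y) v (Y.edgeLetter y :: w)

variable {Y}

theorem eval_append (w w' : List Y.Gen) : Y.eval (w ++ w') = Y.eval w * Y.eval w' := by
  simp [eval]

theorem IsPathWord.append {u v x : V} {w w' : List Y.Gen} (h : Y.IsPathWord u v w)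
    (h' : Y.IsPathWord v x w') : Y.IsPathWord u x (w ++ w') := by
  induction h with
  | nil v => exact h'
  | vertex g _ ih => exact IsPathWord.vertex g (ih h')
  | edge y _ ih => exact IsPathWord.edge y (ih h')

theorem of_vertexLetter_mul {v : V} (g h : Y.vertexGroup v) :
    (PresentedGroup.of (Y.vertexLetter (g * h)) : Y.F) =
      PresentedGroup.of (Y.vertexLetter g) * PresentedGroup.of (Y.vertexLetter h) := by
  have := PresentedGroup.one_of_mem (rels := {r : FreeGroup Y.Gen | Y.Rel r}) (Rel.mul v g h)
  rw [map_mul, map_inv, map_mul] at this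
  exact (mul_inv_eq_one.1 this).symm

theorem of_vertexLetter_inv {v : V} (g : Y.vertexGroup v) :
    (PresentedGroup.of (Y.vertexLetter g⁻¹) : Y.F) =
      (PresentedGroup.of (Y.vertexLetter g))⁻¹ := by
  have h1 : (PresentedGroup.of (Y.vertexLetter (1 : Y.vertexGroup v)) : Y.F) = 1 := by
    have := of_vertexLetter_mul (1 : Y.vertexGroup v) 1
    rw [mul_one] at this
    exact left_eq_mul.1 this
  refine eq_inv_of_mul_eq_one_left ?_
  rw [← of_vertexLetter_mul, inv_mul_cancel, h1]

theorem of_edgeLetter_inv (y : E) :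
    (PresentedGroup.of (Y.edgeLetter (Y.inv y)) : Y.F) =
      (PresentedGroup.of (Y.edgeLetter y))⁻¹ := by
  have := PresentedGroup.one_of_mem (rels := {r : FreeGroup Y.Gen | Y.Rel r}) (Rel.inv y)
  rw [map_mul] at this
  exact eq_inv_of_mul_eq_one_right this

theorem IsPathWord.exists_inv {u v : V} {w : List Y.Gen} (h : Y.IsPathWord u v w) :
    ∃ w', Y.IsPathWord v u w' ∧ Y.eval w' = (Y.eval w)⁻¹ := by
  induction h with
  | nil v => exact ⟨[], IsPathWord.nil v, by simp [eval]⟩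
  | @vertex u v g w _ ih =>
    obtain ⟨w', h', he⟩ := ih
    refine ⟨w' ++ [Y.vertexLetter g⁻¹], h'.append (IsPathWord.vertex _ (IsPathWord.nil _)), ?_⟩
    rw [eval_append, he]
    simp [eval, of_vertexLetter_inv]
  | @edge y v w _ ih =>
    obtain ⟨w', h', he⟩ := ih
    have hy : Y.IsPathWord (Y.tgt y) (Y.src y) [Y.edgeLetter (Y.inv y)] := by
      refine IsPathWord.edge (Y.inv y) ?_
      rw [Y.tgt_inv]
      exact IsPathWord.nil _
    refine ⟨w' ++ [Y.edgeLetter (Y.inv y)], h'.append hy, ?_⟩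
    rw [eval_append, he]
    simp [eval, of_edgeLetter_inv]

variable (Y)

/-- The fundamental group `π₁(G, Y, v₀)`: the subgroup of `F(G, Y)` consisting of the elements
represented by words of cycle type at `v₀`. -/
def fundamentalGroup (v₀ : V) : Subgroup Y.F where
  carrier := {x | ∃ w, Y.IsPathWord v₀ v₀ w ∧ Y.eval w = x}
  mul_mem' := by
    rintro _ _ ⟨w, hw, rfl⟩ ⟨w', hw', rfl⟩
    exact ⟨w ++ w', hw.append hw', eval_append w w'⟩
  one_mem' := ⟨[], IsPathWord.nil v₀, by simp [eval]⟩
  inv_mem' := by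
    rintro _ ⟨w, hw, rfl⟩
    exact hw.exists_inv

end GraphOfGroups

/-! ## Languages over abstract finite alphabets -/

/-! The group `Y.F` is a retract of an iterated HNN extension `K` of the free product of the vertex
groups, with finite associated subgroups. The theorem then rests on two facts about word problems.

Passing to a subgroup is an inverse morphism: if a finitely generated group embeds in a group with
word problem in `C`, its generators can be spelled in the larger group
(`HasWordProblemIn.of_injective`). Building larger groups is monadic rewriting: for free products
(`HasWordProblemIn.coprodI`) and for HNN extensions with finite associated subgroups
(`HasWordProblemIn.hnnExtension`), rules with left-hand languages in `C` bring every word to a form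
covered by the normal form theorem, respectively by Britton's lemma. The ancestors of the empty word
are then exactly the words of value `1`.

Hence `K` has word problem in `C` if all vertex groups do, and so does the fundamental group, which
is finitely generated (`GraphOfGroups.fundamentalGroup_fg`) and embeds in `K`. Conversely, the
vertex groups embed in `K`, hence in `Y.F`; in a connected graph, conjugation along a path embeds
each of them in the fundamental group. -/

theorem nonempty_embedding_of_finite_of_infinite (D S : Type*) [Finite D] [Infinite S] :
    Nonempty (D ↪ S) := by
  cases nonempty_fintype D
  exact ⟨((Fintype.equivFin D).toEmbedding.trans Fin.valEmbedding).trans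
    (Infinite.natEmbedding S)⟩

namespace LanguageClass

variable {S : Type u₁} (C : LanguageClass S)

/-- A language over an abstract alphabet `D` belongs to the class `C` after some embedding of the
alphabet `D` in the set of symbols. -/
def Contains {D : Type*} (L : Set (List D)) : Prop :=
  ∃ e : D ↪ S, (List.map e '' L : Set (List S)) ∈ C.carrier

variable {C}

/-- The embedding `e` is arbitrary, so `Contains` does not depend on its witness over a finite
alphabet: several languages can be coded by the same symbols. -/
theorem Contains.map_comap_mem (hinv : C.ClosedUnderInverseMorphism) {D D' : Type*} [Finite D]
    {L : Set (List D')} (hL : C.Contains L) (f : D → List D') (e : D ↪ S) :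
    (List.map e '' {w | w.flatMap f ∈ L} : Set (List S)) ∈ C.carrier := by
  classical
  cases nonempty_fintype D
  obtain ⟨e', he'⟩ := hL
  -- The value `[]` off the range of `e` plays no role: only words over that range are tested.
  have key := hinv (Finset.univ.map e)
    (Function.extend e (fun d => (f d).map e') (fun _ => [])) _ he'
  have hfl : ∀ w : List D, (w.map e).flatMap
      (Function.extend e (fun d => (f d).map e') (fun _ => [])) = (w.flatMap f).map e' := by
    intro w
    induction w with
    | nil => rfl
    | cons d w ih => simp [ih, e.injective.extend_apply]
  refine Eq.mp (congrArg (· ∈ C.carrier) (Set.ext fun w => Iff.symm ?_)) key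
  constructor
  · rintro ⟨w, hw, rfl⟩
    refine ⟨fun a ha => ?_, w.flatMap f, hw, (hfl w).symm⟩
    obtain ⟨d, -, rfl⟩ := List.mem_map.1 ha
    simp
  · rintro ⟨hw, v, hv, hvw⟩
    obtain ⟨w, rfl⟩ : w ∈ Set.range (List.map e) := by
      rw [Set.range_list_map]
      intro a ha
      simpa using hw a ha
    refine ⟨w, ?_, rfl⟩
    rw [hfl] at hvw
    rw [e'.injective.list_map hvw] at hv
    exact hv

theorem Contains.comap [Infinite S] (hinv : C.ClosedUnderInverseMorphism) {D D' : Type*}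
    [Finite D] {L : Set (List D')} (hL : C.Contains L) (f : D → List D') :
    C.Contains {w | w.flatMap f ∈ L} := by
  obtain ⟨e⟩ := nonempty_embedding_of_finite_of_infinite D S
  exact ⟨e, hL.map_comap_mem hinv f e⟩

theorem Contains.map_mem (hinv : C.ClosedUnderInverseMorphism) {D : Type*} [Finite D]
    {L : Set (List D)} (hL : C.Contains L) (e : D ↪ S) :
    (List.map e '' L : Set (List S)) ∈ C.carrier := by
  have h := hL.map_comap_mem hinv (fun d => [d]) e
  simpa using h

theorem Contains.map [Infinite S] (hinv : C.ClosedUnderInverseMorphism) {D D' : Type*} [Finite D]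
    [Finite D'] {L : Set (List D)} (hL : C.Contains L) (i : D ↪ D') :
    C.Contains (List.map i '' L) := by
  obtain ⟨e⟩ := nonempty_embedding_of_finite_of_infinite D' S
  refine ⟨e, ?_⟩
  have h := hL.map_mem hinv (i.trans e)
  rwa [Set.image_image, show (fun w => List.map e (List.map i w)) = List.map (i.trans e) from
    funext fun w => List.map_map]

theorem Contains.append_left (hleft : C.ClosedUnderLeftTranslation) {D : Type*}
    {L : Set (List D)} (hL : C.Contains L) (w : List D) :
    C.Contains ((fun x => w ++ x) '' L) := by
  obtain ⟨e, he⟩ := hL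
  refine ⟨e, ?_⟩
  convert hleft (w.map e) _ he using 1
  ext u
  constructor
  · rintro ⟨_, ⟨x, hx, rfl⟩, rfl⟩
    exact ⟨x.map e, ⟨x, hx, rfl⟩, by simp⟩
  · rintro ⟨_, ⟨x, hx, rfl⟩, rfl⟩
    exact ⟨w ++ x, ⟨x, hx, rfl⟩, by simp⟩

theorem Contains.append_right (hright : C.ClosedUnderRightTranslation) {D : Type*}
    {L : Set (List D)} (hL : C.Contains L) (w : List D) :
    C.Contains ((fun x => x ++ w) '' L) := by
  obtain ⟨e, he⟩ := hL
  refine ⟨e, ?_⟩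
  convert hright (w.map e) _ he using 1
  ext u
  constructor
  · rintro ⟨_, ⟨x, hx, rfl⟩, rfl⟩
    exact ⟨x.map e, ⟨x, hx, rfl⟩, by simp⟩
  · rintro ⟨_, ⟨x, hx, rfl⟩, rfl⟩
    exact ⟨x ++ w, ⟨x, hx, rfl⟩, by simp⟩

theorem Contains.empty [Infinite S] (hinv : C.ClosedUnderInverseMorphism)
    (hleft : C.ClosedUnderLeftTranslation) {D D' : Type*} [Finite D] [Finite D']
    {L : Set (List D')} (hL : C.Contains L) : C.Contains (∅ : Set (List D)) := by
  -- Every word of the translate starts with the new letter `none`, whereas the erasing morphism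
  -- yields only the empty word; the inverse image is therefore empty.
  have h := ((hL.map hinv (Function.Embedding.some (α := D'))).append_left hleft [none]).comap
    hinv (fun _ : D => [])
  convert h using 1
  ext w
  have hw : w.flatMap (fun _ => ([] : List (Option D'))) = [] := by simp
  simp [hw]

end LanguageClass

/-! ## Monadic rewriting over abstract alphabets -/

/-- One-step rewriting for the rules `w → x`, `w ∈ R x`. -/
def MonadicStep {D : Type*} (R : Option D → Set (List D)) (u v : List D) : Prop :=
  ∃ (r s w : List D) (x : Option D), w ∈ R x ∧ u = r ++ w ++ s ∧ v = r ++ x.toList ++ s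

/-- Rewriting for the rules `w → x`, `w ∈ R x`. -/
def MonadicReduces {D : Type*} (R : Option D → Set (List D)) : List D → List D → Prop :=
  Relation.ReflTransGen (MonadicStep R)

namespace MonadicReduces

variable {D : Type*} {R : Option D → Set (List D)}

theorem rule {w : List D} {x : Option D} (h : w ∈ R x) : MonadicReduces R w x.toList :=
  Relation.ReflTransGen.single ⟨[], [], w, x, h, by simp, by simp⟩

theorem context {u v : List D} (h : MonadicReduces R u v) (p q : List D) :
    MonadicReduces R (p ++ u ++ q) (p ++ v ++ q) := by
  refine Relation.ReflTransGen.lift (fun u => p ++ u ++ q) ?_ _ _ h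
  rintro u v ⟨r, s, w, x, hw, rfl, rfl⟩
  exact ⟨p ++ r, s ++ q, w, x, hw, by simp, by simp⟩

theorem append_left {u v : List D} (h : MonadicReduces R u v) (p : List D) :
    MonadicReduces R (p ++ u) (p ++ v) := by
  simpa using h.context p []

theorem append_right {u v : List D} (h : MonadicReduces R u v) (q : List D) :
    MonadicReduces R (u ++ q) (v ++ q) := by
  simpa using h.context [] q

theorem prod_eq {K : Type*} [Group K] (τ : D → K)
    (hR : ∀ x, ∀ w ∈ R x, (w.map τ).prod = (x.toList.map τ).prod) {u v : List D}
    (h : MonadicReduces R u v) : (u.map τ).prod = (v.map τ).prod := by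
  induction h with
  | refl => rfl
  | tail _ h ih =>
    obtain ⟨r, s, w, x, hw, rfl, rfl⟩ := h
    rw [ih]
    simp only [List.map_append, List.prod_append, hR x w hw]

end MonadicReduces

theorem LanguageClass.contains_ancestors {S : Type u₁} [Infinite S] {C : LanguageClass S}
    (hinv : C.ClosedUnderInverseMorphism) (hanc : C.ClosedUnderAncestorsOfEmptyWord)
    {D : Type*} [Finite D] (R : Option D → Set (List D)) (hR : ∀ x, C.Contains (R x)) :
    C.Contains {u | MonadicReduces R u []} := by
  classical
  cases nonempty_fintype D
  -- Any embedding of the alphabet serves here; all the languages `R x` are transported along this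
  -- one.
  obtain ⟨e, -⟩ := hR none
  refine ⟨e, ?_⟩
  let Γ : MonadicSystem (Finset.univ.map e) :=
    { rules := {p | ∃ x, ∃ w ∈ R x, p = (w.map e, x.map e)}
      lhs_mem := by
        rintro _ _ ⟨x, w, -, h⟩ a ha
        obtain ⟨rfl, rfl⟩ := Prod.mk.inj h
        obtain ⟨d, -, rfl⟩ := List.mem_map.1 ha
        simp
      rhs_mem := by
        rintro _ a ⟨x, w, -, h⟩
        obtain ⟨d, -, rfl⟩ := Option.map_eq_some_iff.1 (Prod.mk.inj h).2.symm
        simp }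
  have hlhs : ∀ x, Γ.lhs (x.map e) = (List.map e '' R x : Set (List S)) := by
    intro x
    ext w
    constructor
    · rintro ⟨x', w, hw, h⟩
      obtain ⟨rfl, h'⟩ := Prod.mk.inj h
      rw [Option.map_injective e.injective h']
      exact ⟨w, hw, rfl⟩
    · rintro ⟨w, hw, rfl⟩
      exact ⟨x, w, hw, rfl⟩
  have hΓ : Γ.IsMonadicFor C := by
    refine ⟨?_, fun a ha => ?_⟩
    · have := hlhs none
      rw [Option.map_none] at this
      rw [this]
      exact (hR none).map_mem hinv e
    · obtain ⟨d, -, rfl⟩ := Finset.mem_map.1 ha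
      have := hlhs (some d)
      rw [Option.map_some] at this
      rw [this]
      exact (hR (some d)).map_mem hinv e
  refine Eq.mp (congrArg (· ∈ C.carrier) (Set.ext fun u => Iff.symm ?_)) (hanc _ Γ hΓ)
  constructor
  · rintro ⟨u, hu, rfl⟩
    refine ⟨fun a ha => ?_, [], rfl, ?_⟩
    · obtain ⟨d, -, rfl⟩ := List.mem_map.1 ha
      simp
    · refine Relation.ReflTransGen.lift (List.map e) ?_ _ _ hu
      rintro _ _ ⟨r, s, w, x, hw, rfl, rfl⟩
      refine ⟨r.map e, s.map e, w.map e, x.map e, ⟨x, w, hw, rfl⟩, by simp, ?_⟩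
      cases x <;> simp
  · rintro ⟨hu, v, rfl, h⟩
    obtain ⟨u, rfl⟩ : u ∈ Set.range (List.map e) := by
      rw [Set.range_list_map]
      intro a ha
      simpa using hu a ha
    refine ⟨u, ?_, rfl⟩
    -- Rewriting never leaves the range of `List.map e`, so derivations lift letter by letter.
    suffices ∀ u' v' : List S, Relation.ReflTransGen Γ.Step u' v' → ∀ u, u' = List.map e u →
        ∃ v, v' = List.map e v ∧ MonadicReduces R u v by
      obtain ⟨v, hv, h⟩ := this _ _ h u rfl
      rwa [List.map_eq_nil_iff.1 hv.symm] at h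
    intro u' v' h u hu
    induction h with
    | refl => exact ⟨u, hu, Relation.ReflTransGen.refl⟩
    | tail _ h ih =>
      obtain ⟨v, rfl, hv⟩ := ih
      obtain ⟨r, s, _, _, ⟨x, w, hw, hx⟩, h, rfl⟩ := h
      obtain ⟨rfl, rfl⟩ := Prod.mk.inj hx
      obtain ⟨v₁, s, rfl, h₁, rfl⟩ := List.map_eq_append_iff.1 h
      obtain ⟨r, w', rfl, rfl, h₂⟩ := List.map_eq_append_iff.1 h₁
      rw [e.injective.list_map h₂] at hv
      refine ⟨r ++ x.toList ++ s, ?_, hv.tail ⟨r, s, w, x, hw, rfl, rfl⟩⟩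
      cases x <;> simp

/-! ## Word problems over abstract alphabets -/

section WordProblem

variable {S : Type u₁} {C : LanguageClass S} {G : Type u₂} [Group G]

theorem image_setOf_prod_eq_one {D : Type*} [Fintype D] (e : D ↪ S) (σ : D → G) :
    (List.map e '' {w | (w.map σ).prod = 1} : Set (List S)) =
      wordProblem (Finset.univ.map e) (Function.extend e σ 1) := by
  have hmap : ∀ w : List D, (w.map e).map (Function.extend e σ 1) = w.map σ := by
    intro w
    simp [e.injective.extend_apply]
  ext u
  constructor
  · rintro ⟨u, hu, rfl⟩
    refine ⟨fun a ha => ?_, ?_⟩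
    · obtain ⟨d, -, rfl⟩ := List.mem_map.1 ha
      simp
    · rw [hmap]
      exact hu
  · rintro ⟨hu, h⟩
    obtain ⟨u, rfl⟩ : u ∈ Set.range (List.map e) := by
      rw [Set.range_list_map]
      intro a ha
      simpa using hu a ha
    rw [hmap] at h
    exact ⟨u, h, rfl⟩

theorem HasWordProblemIn.contains [Infinite S] (hinv : C.ClosedUnderInverseMorphism)
    (h : HasWordProblemIn C G) {D : Type*} [Finite D] (σ : D → G) :
    C.Contains {w | (w.map σ).prod = 1} := by
  cases nonempty_fintype D
  obtain ⟨e⟩ := nonempty_embedding_of_finite_of_infinite D S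
  refine ⟨e, ?_⟩
  rw [image_setOf_prod_eq_one]
  exact h.wordProblem_mem hinv _ _

theorem HasWordProblemIn.of_contains {D : Type*} [Finite D] {σ : D → G}
    (hσ : Submonoid.closure (Set.range σ) = ⊤) (h : C.Contains {w | (w.map σ).prod = 1}) :
    HasWordProblemIn C G := by
  cases nonempty_fintype D
  obtain ⟨e, he⟩ := h
  refine ⟨Finset.univ.map e, Function.extend e σ 1, ?_, ?_⟩
  · rw [IsGenerating, Finset.coe_map, Finset.coe_univ, Set.image_univ, ← Set.range_comp]
    convert hσ
    exact Function.extend_comp e.injective _ _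
  · rwa [← image_setOf_prod_eq_one]

theorem HasWordProblemIn.fg (h : HasWordProblemIn C G) : Group.FG G := by
  obtain ⟨A, σ, hA, -⟩ := h
  rw [Group.fg_iff_monoid_fg, Monoid.fg_iff]
  exact ⟨_, hA, A.finite_toSet.image σ⟩

theorem Group.FG.exists_submonoid_closure_eq_top (h : Group.FG G) :
    ∃ (n : ℕ) (σ : Fin n → G), Submonoid.closure (Set.range σ) = ⊤ := by
  rw [Group.fg_iff_monoid_fg, Monoid.fg_iff] at h
  obtain ⟨s, hs, hfin⟩ := h
  obtain ⟨n, σ, -, rfl⟩ := hfin.fin_param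
  exact ⟨n, σ, hs⟩

/-- The images in `K` of generators of `G` need not generate `K`: `HasWordProblemIn.contains`
applies to every finite family. -/
theorem HasWordProblemIn.of_injective [Infinite S] (hinv : C.ClosedUnderInverseMorphism)
    {K : Type*} [Group K] (h : HasWordProblemIn C K) (hG : Group.FG G) (f : G →* K)
    (hf : Function.Injective f) : HasWordProblemIn C G := by
  obtain ⟨n, σ, hσ⟩ := hG.exists_submonoid_closure_eq_top
  refine HasWordProblemIn.of_contains hσ ?_
  convert h.contains hinv (f ∘ σ) using 3 with w
  rw [← List.map_map, ← map_list_prod, map_eq_one_iff f hf]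

/-- If the word problem of `G` lies in `C`, then so does the set of words representing `g`. -/
theorem HasWordProblemIn.contains_fiber [Infinite S] (hinv : C.ClosedUnderInverseMorphism)
    (hleft : C.ClosedUnderLeftTranslation) (h : HasWordProblemIn C G) {D : Type*} [Finite D]
    (σ : D → G) (g : G) : C.Contains {w | (w.map σ).prod = g} := by
  by_cases hg : g = 1
  · subst hg
    exact h.contains hinv σ
  -- The letters `Sum.inr true` and `Sum.inr false` stand for `g` and `g⁻¹`. The morphism `d ↦ g d
  -- g⁻¹` sends a nonempty word of value `x` to a word which starts with the letter `g` and has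
  -- value `g x g⁻¹`. It lies in the translated word problem iff the rest, of value `x g⁻¹`, is
  -- trivial. The empty word is not in the inverse image, as it should be since `g ≠ 1`.
  let τ : D ⊕ Bool → G := Sum.elim σ (fun b => if b then g else g⁻¹)
  have key := ((h.contains hinv τ).append_left hleft [Sum.inr true]).comap hinv
    (fun d : D => [Sum.inr true, Sum.inl d, Sum.inr false])
  convert key using 1
  have hprod : ∀ w : List D, ((w.flatMap fun d : D =>
      [Sum.inr true, Sum.inl d, Sum.inr false]).map τ).prod = g * (w.map σ).prod * g⁻¹ := by
    intro w
    induction w with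
    | nil => simp
    | cons d w ih =>
      rw [List.flatMap_cons, List.map_append, List.prod_append, ih]
      simp [τ, mul_assoc]
  ext w
  cases w with
  | nil => simpa using Ne.symm hg
  | cons d w =>
    have h1 := hprod (d :: w)
    simp only [List.flatMap_cons, List.cons_append, List.nil_append, List.map_cons,
      List.prod_cons] at h1
    simp only [Set.mem_ofPred_eq, List.flatMap_cons, List.cons_append, List.nil_append,
      Set.mem_image, List.cons.injEq, true_and, exists_eq_right, List.map_cons, List.prod_cons]
    rw [show τ (Sum.inr true) = g by simp [τ], mul_assoc g, mul_right_inj] at h1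
    rw [h1, mul_inv_eq_one]

end WordProblem

/-! ## Free products -/

namespace FreeProductRewriting

variable {ι : Type*} {D : ι → Type*} {G : ι → Type*} [∀ i, Group (G i)] (σ : ∀ i, D i → G i)

/-- The rules which delete words over the alphabet of a factor with trivial value, through
auxiliary letters `Sum.inr i`. -/
def rules : Option ((Σ i, D i) ⊕ ι) → Set (List ((Σ i, D i) ⊕ ι))
  | none => List.map Sum.inr '' Set.univ
  | some (Sum.inr i) => List.map (fun d => Sum.inl ⟨i, d⟩) '' {w | (w.map (σ i)).prod = 1}
  | some (Sum.inl _) => ∅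

/-- The word given by a list of syllables. -/
def flatten (ss : List (Σ i, List (D i))) : List ((Σ i, D i) ⊕ ι) :=
  ss.flatMap fun p => p.2.map fun d => Sum.inl ⟨p.1, d⟩

/-- A list of syllables is reduced if all values are nontrivial and consecutive syllables come from
different factors. -/
def IsReduced (ss : List (Σ i, List (D i))) : Prop :=
  (∀ p ∈ ss, (p.2.map (σ p.1)).prod ≠ 1) ∧ ss.IsChain fun p q => p.1 ≠ q.1

/-- The interpretation of the letters in the free product. -/
def value : (Σ i, D i) ⊕ ι → Monoid.CoprodI G :=
  Sum.elim (fun p => Monoid.CoprodI.of (σ p.1 p.2)) (fun _ => 1)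

theorem prod_map_value_inl (i : ι) (w : List (D i)) :
    ((w.map fun d => (Sum.inl ⟨i, d⟩ : (Σ i, D i) ⊕ ι)).map (value σ)).prod =
      Monoid.CoprodI.of (w.map (σ i)).prod := by
  rw [List.map_map, map_list_prod, List.map_map]
  rfl

theorem reduces_inr (i : ι) : MonadicReduces (rules σ) [Sum.inr i] [] :=
  MonadicReduces.rule (x := none) ⟨[i], trivial, rfl⟩

theorem reduces_nil {i : ι} {w : List (D i)} (hw : (w.map (σ i)).prod = 1) :
    MonadicReduces (rules σ) (w.map fun d => Sum.inl ⟨i, d⟩) [] :=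
  (MonadicReduces.rule (R := rules σ) (x := some (Sum.inr i)) ⟨w, hw, rfl⟩).trans (reduces_inr σ i)

variable {σ}

theorem IsReduced.exists_cons_of_head_ne {ss : List (Σ i, List (D i))} (h : IsReduced σ ss)
    {i : ι} (hi : ∀ p ∈ ss.head?, i ≠ p.1) (w : List (D i)) :
    ∃ ss', IsReduced σ ss' ∧ MonadicReduces (rules σ)
      ((w.map fun d => Sum.inl ⟨i, d⟩) ++ flatten ss) (flatten ss') := by
  by_cases hw : (w.map (σ i)).prod = 1
  · exact ⟨ss, h, (reduces_nil σ hw).append_right _⟩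
  · refine ⟨⟨i, w⟩ :: ss, ⟨?_, List.isChain_cons.2 ⟨hi, h.2⟩⟩, Relation.ReflTransGen.refl⟩
    intro p hp
    rcases List.mem_cons.1 hp with rfl | hp
    · exact hw
    · exact h.1 p hp

theorem IsReduced.exists_cons {ss : List (Σ i, List (D i))} (h : IsReduced σ ss) {i : ι}
    (w : List (D i)) :
    ∃ ss', IsReduced σ ss' ∧ MonadicReduces (rules σ)
      ((w.map fun d => Sum.inl ⟨i, d⟩) ++ flatten ss) (flatten ss') := by
  rcases ss with _ | ⟨⟨j, v⟩, ss⟩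
  · exact h.exists_cons_of_head_ne (by simp) w
  · by_cases hij : i = j
    · subst hij
      have hc := List.isChain_cons.1 h.2
      have h' : IsReduced σ ss := ⟨fun p hp => h.1 p (List.mem_cons_of_mem _ hp), hc.2⟩
      -- The two syllables merge into `w ++ v`. The next syllable lies in another factor, so the
      -- list stays reduced even if the merged syllable is trivial and gets deleted.
      simpa [flatten] using h'.exists_cons_of_head_ne hc.1 (w ++ v)
    · exact h.exists_cons_of_head_ne (by simpa using hij) w

variable (σ)

theorem exists_isReduced (u : List ((Σ i, D i) ⊕ ι)) :
    ∃ ss, IsReduced σ ss ∧ MonadicReduces (rules σ) u (flatten ss) := by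
  induction u with
  | nil => exact ⟨[], ⟨by simp, List.isChain_nil⟩, Relation.ReflTransGen.refl⟩
  | cons d u ih =>
    obtain ⟨ss, hss, hu⟩ := ih
    rcases d with ⟨i, d⟩ | i
    · obtain ⟨ss', hss', h⟩ := hss.exists_cons [d]
      exact ⟨ss', hss', (hu.append_left [Sum.inl ⟨i, d⟩]).trans h⟩
    · exact ⟨ss, hss, ((reduces_inr σ i).append_right u).trans hu⟩

variable {σ}

/-- The values of the syllables form a reduced word of the free product, and only the empty one has
product `1`. -/
theorem IsReduced.eq_nil {ss : List (Σ i, List (D i))} (h : IsReduced σ ss)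
    (hprod : ((flatten ss).map (value σ)).prod = 1) : ss = [] := by
  classical
  let W : Monoid.CoprodI.Word G :=
    { toList := ss.map fun p => ⟨p.1, (p.2.map (σ p.1)).prod⟩
      ne_one := by
        intro l hl
        obtain ⟨p, hp, rfl⟩ := List.mem_map.1 hl
        exact h.1 p hp
      chain_ne := (List.isChain_map _).2 h.2 }
  have hW : W.prod = ((flatten ss).map (value σ)).prod := by
    simp only [Monoid.CoprodI.Word.prod, W, flatten]
    clear hprod h W
    induction ss with
    | nil => rfl
    | cons p ss ih =>
      rw [List.flatMap_cons, List.map_append, List.prod_append, prod_map_value_inl, ← ih]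
      simp
  have : W = Monoid.CoprodI.Word.empty := by
    apply Monoid.CoprodI.Word.equiv.symm.injective
    change W.prod = Monoid.CoprodI.Word.prod _
    rw [hW, hprod, Monoid.CoprodI.Word.prod_empty]
  have := congrArg Monoid.CoprodI.Word.toList this
  exact List.map_eq_nil_iff.1 this

variable (σ)

/-- Rules preserve values. For the converse no confluence is needed: a word of value `1` reduces to
some reduced list, which the normal form theorem forces to be empty. -/
theorem reduces_nil_iff (u : List ((Σ i, D i) ⊕ ι)) :
    MonadicReduces (rules σ) u [] ↔ (u.map (value σ)).prod = 1 := by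
  have hsound : ∀ x, ∀ w ∈ rules σ x, (w.map (value σ)).prod = (x.toList.map (value σ)).prod := by
    rintro (_ | _ | i) w hw
    · obtain ⟨w, -, rfl⟩ := hw
      rw [List.map_map]
      exact List.prod_eq_one fun _ hx => by
        obtain ⟨i, -, rfl⟩ := List.mem_map.1 hx
        rfl
    · exact absurd hw (Set.notMem_empty _)
    · obtain ⟨w, hw, rfl⟩ := hw
      rw [prod_map_value_inl, show (w.map (σ i)).prod = 1 from hw]
      simp [value]
  refine ⟨fun h => h.prod_eq _ hsound, fun h => ?_⟩
  obtain ⟨ss, hss, hu⟩ := exists_isReduced σ u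
  rw [hu.prod_eq _ hsound] at h
  rw [hss.eq_nil h] at hu
  exact hu

end FreeProductRewriting

/-- The word problems of the factors rewrite to different letters `Sum.inr i`, so each left-hand
language comes from a single group and no closure under union is required. -/
theorem HasWordProblemIn.coprodI {S : Type u₁} [Infinite S] {C : LanguageClass S}
    (hinv : C.ClosedUnderInverseMorphism) (hleft : C.ClosedUnderLeftTranslation)
    (hanc : C.ClosedUnderAncestorsOfEmptyWord) {ι : Type*} [Finite ι] [Nonempty ι]
    {G : ι → Type*} [∀ i, Group (G i)] (h : ∀ i, HasWordProblemIn C (G i)) :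
    HasWordProblemIn C (Monoid.CoprodI G) := by
  choose n σ hσ using fun i => (h i).fg.exists_submonoid_closure_eq_top
  refine HasWordProblemIn.of_contains (σ := FreeProductRewriting.value σ) ?_ ?_
  · rw [eq_top_iff, ← Monoid.CoprodI.iSup_mrange_of, iSup_le_iff]
    intro i
    rw [MonoidHom.mrange_eq_map, ← hσ i, MonoidHom.map_mclosure]
    refine Submonoid.closure_mono ?_
    rintro _ ⟨_, ⟨d, rfl⟩, rfl⟩
    exact ⟨Sum.inl ⟨i, d⟩, rfl⟩
  · simp only [← FreeProductRewriting.reduces_nil_iff]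
    refine LanguageClass.contains_ancestors hinv hanc _ ?_
    rintro (_ | _ | i)
    · obtain ⟨i⟩ := ‹Nonempty ι›
      have := ((h i).contains hinv (fun _ : ι => 1)).map hinv
        (Function.Embedding.inr (α := Σ i, Fin (n i)))
      simp only [List.map_const', List.prod_replicate, one_pow, Set.ofPred_true] at this
      exact this
    · exact ((h (Classical.arbitrary ι)).contains hinv (fun _ : ι => 1)).empty hinv hleft
    · exact ((h i).contains hinv (σ i)).map hinv
        ((Function.Embedding.sigmaMk (β := fun i => Fin (n i)) i).trans Function.Embedding.inl)

/-! ## HNN extensions with finite associated subgroups -/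

namespace HNNExtension

section

variable {G : Type*} [Group G] {A B : Subgroup G} (φ : A ≃* B)

theorem t_zpow_mul_of (u : ℤˣ) (a : toSubgroup A B u) :
    (t ^ (u : ℤ) * of (a : G) * t ^ (-(u : ℤ)) : HNNExtension G A B φ) =
      of (toSubgroupEquiv φ u a : G) := by
  rcases Int.units_eq_one_or u with rfl | rfl
  · simp only [Units.val_one, zpow_one, zpow_neg]
    exact (equiv_eq_conj (φ := φ) a).symm
  · simp only [Units.val_neg, Units.val_one, zpow_one, zpow_neg, neg_neg]
    exact (equiv_symm_eq_conj (φ := φ) a).symm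

end

/-- An alphabet for an HNN extension of a group with alphabet `D`: the letters of `D`, a letter for
each element of the associated subgroups, and two letters for the stable letter and its inverse. -/
abbrev Letter (D : Type*) {G : Type*} [Group G] (A B : Subgroup G) : Type _ :=
  (D ⊕ Σ u : ℤˣ, toSubgroup A B u) ⊕ ℤˣ

namespace Rewriting

variable {D G : Type*} [Group G] {A B : Subgroup G} (φ : A ≃* B) (σ : D → G)

/-- The interpretation in the base group of the letters other than the stable ones. -/
def baseValue : D ⊕ (Σ u : ℤˣ, toSubgroup A B u) → G :=
  Sum.elim σ fun p => p.2

/-- The interpretation of the letters. -/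
def value : Letter D A B → HNNExtension G A B φ :=
  Sum.elim (fun d => of (baseValue σ d)) fun u => t ^ (u : ℤ)

/-- The rules which delete words over the base group with trivial value, and replace the conjugate
by the stable letter of a word with value in an associated subgroup by the corresponding letter. -/
def rules : Option (Letter D A B) → Set (List (Letter D A B))
  | none => List.map Sum.inl '' {w | (w.map (baseValue σ)).prod = 1}
  | some (Sum.inl (Sum.inr ⟨u, a⟩)) =>
      (fun x => x ++ [Sum.inr u]) '' ((fun x => [Sum.inr (-u)] ++ x) ''
        (List.map Sum.inl '' {w | (w.map (baseValue σ)).prod = (toSubgroupEquiv φ u a : G)}))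
  | some (Sum.inl (Sum.inl _)) => ∅
  | some (Sum.inr _) => ∅

theorem prod_map_value_inl (w : List (D ⊕ Σ u : ℤˣ, toSubgroup A B u)) :
    ((w.map Sum.inl).map (value φ σ)).prod = of (w.map (baseValue σ)).prod := by
  rw [List.map_map, map_list_prod, List.map_map]
  rfl

theorem prod_map_value_of_mem_rules (x : Option (Letter D A B)) :
    ∀ w ∈ rules φ σ x, (w.map (value φ σ)).prod = (x.toList.map (value φ σ)).prod := by
  rcases x with _ | (_ | ⟨u, a⟩) | _
  · rintro _ ⟨w, hw, rfl⟩
    rw [prod_map_value_inl, show (w.map (baseValue σ)).prod = 1 from hw]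
    simp
  · exact fun w hw => absurd hw (Set.notMem_empty _)
  · rintro _ ⟨_, ⟨_, ⟨w, hw, rfl⟩, rfl⟩, rfl⟩
    dsimp only
    rw [List.map_append, List.map_append, List.prod_append, List.prod_append, prod_map_value_inl,
      show (w.map (baseValue σ)).prod = _ from hw]
    have := t_zpow_mul_of φ (-u) (toSubgroupEquiv φ u a)
    rw [toSubgroupEquiv_neg_apply] at this
    simpa [value, baseValue] using this
  · exact fun w hw => absurd hw (Set.notMem_empty _)

/-- The word `t ^ u₁ w₁ ⋯ t ^ uₙ wₙ` given by a list of pairs `(uᵢ, wᵢ)`. -/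
def flatten (ss : List (ℤˣ × List (D ⊕ Σ u : ℤˣ, toSubgroup A B u))) : List (Letter D A B) :=
  ss.flatMap fun p => Sum.inr p.1 :: p.2.map Sum.inl

/-- Britton's condition: there are no factors `t ^ u w t ^ (-u)` with the value of `w` in the
corresponding associated subgroup. -/
def IsReduced (ss : List (ℤˣ × List (D ⊕ Σ u : ℤˣ, toSubgroup A B u))) : Prop :=
  ss.IsChain fun p q => (p.2.map (baseValue σ)).prod ∈ toSubgroup A B p.1 → p.1 = q.1

/-- Letters are prepended one at a time. Only a stable letter can violate Britton's condition, and
only at the front; one rule then turns the pinch into a letter of an associated subgroup, absorbed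
by the following base word. -/
theorem exists_isReduced (u : List (Letter D A B)) :
    ∃ (w : List (D ⊕ Σ u : ℤˣ, toSubgroup A B u))
      (ss : List (ℤˣ × List (D ⊕ Σ u : ℤˣ, toSubgroup A B u))), IsReduced σ ss ∧
      MonadicReduces (rules φ σ) u (w.map Sum.inl ++ flatten ss) := by
  induction u with
  | nil => exact ⟨[], [], List.isChain_nil, Relation.ReflTransGen.refl⟩
  | cons d u ih =>
    obtain ⟨w, ss, hss, hu⟩ := ih
    have hu' := hu.append_left [d]
    rcases d with d | ε
    · exact ⟨d :: w, ss, hss, hu'⟩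
    · by_cases hc : IsReduced σ ((ε, w) :: ss)
      · exact ⟨[], (ε, w) :: ss, hc, by simpa [flatten] using hu'⟩
      · rcases ss with _ | ⟨⟨ε', v⟩, ss⟩
        · exact absurd (List.isChain_singleton _) hc
        · rw [IsReduced, List.isChain_cons_cons] at hc
          have hc' : ¬((w.map (baseValue σ)).prod ∈ toSubgroup A B ε → ε = ε') :=
            fun h => hc ⟨h, hss⟩
          obtain ⟨hmem, hne⟩ := Classical.not_imp.1 hc'
          obtain rfl : ε' = -ε := (Int.units_ne_iff_eq_neg.1 (Ne.symm hne))
          let a : toSubgroup A B (-ε) := toSubgroupEquiv φ ε ⟨_, hmem⟩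
          refine ⟨Sum.inr ⟨-ε, a⟩ :: v, ss, (List.isChain_cons.1 hss).2, Relation.ReflTransGen.trans hu' ?_⟩
          -- The left-hand sides for the letter `⟨-ε, a⟩` begin with the stable letter of sign `-
          -- -ε`, that is `ε`.
          have hrule : MonadicReduces (rules φ σ)
              ([Sum.inr (- -ε)] ++ w.map Sum.inl ++ [Sum.inr (-ε)])
              [Sum.inl (Sum.inr ⟨-ε, a⟩)] :=
            MonadicReduces.rule (R := rules φ σ) (x := some (Sum.inl (Sum.inr ⟨-ε, a⟩)))
              ⟨[Sum.inr (- -ε)] ++ w.map Sum.inl,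
                ⟨w.map Sum.inl, ⟨w, (toSubgroupEquiv_neg_apply φ ε ⟨_, hmem⟩).symm, rfl⟩, rfl⟩, rfl⟩
          change MonadicReduces _ _ _
          simpa [flatten] using hrule.append_right (v.map Sum.inl ++ flatten ss)

variable {σ} in
-- Britton's lemma: a reduced word whose value lies in the base group has no stable letter.
theorem IsReduced.eq_nil {w : List (D ⊕ Σ u : ℤˣ, toSubgroup A B u)}
    {ss : List (ℤˣ × List (D ⊕ Σ u : ℤˣ, toSubgroup A B u))} (h : IsReduced σ ss)
    (hprod : ((w.map Sum.inl ++ flatten ss).map (value φ σ)).prod = 1) : ss = [] := by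
  let W : NormalWord.ReducedWord G A B :=
    { head := (w.map (baseValue σ)).prod
      toList := ss.map fun p => (p.1, (p.2.map (baseValue σ)).prod)
      chain := by rw [List.isChain_map]; exact h }
  have hW : W.prod φ = ((w.map Sum.inl ++ flatten ss).map (value φ σ)).prod := by
    rw [List.map_append, List.prod_append, prod_map_value_inl]
    simp only [NormalWord.ReducedWord.prod, W, flatten]
    congr 1
    clear hprod h W
    induction ss with
    | nil => rfl
    | cons p ss ih =>
      rw [List.flatMap_cons, List.map_append, List.prod_append, ← ih, List.map_cons,
        List.map_cons, List.prod_cons, List.map_cons, List.prod_cons, prod_map_value_inl]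
      simp [value]
  have := ReducedWord.toList_eq_nil_of_mem_of_range φ W (by rw [hW, hprod]; exact one_mem _)
  exact List.map_eq_nil_iff.1 this

theorem reduces_nil_iff (u : List (Letter D A B)) :
    MonadicReduces (rules φ σ) u [] ↔ (u.map (value φ σ)).prod = 1 := by
  have hsound := prod_map_value_of_mem_rules φ σ
  refine ⟨fun h => h.prod_eq _ hsound, fun h => ?_⟩
  obtain ⟨w, ss, hss, hu⟩ := exists_isReduced φ σ u
  rw [hu.prod_eq _ hsound] at h
  obtain rfl := hss.eq_nil φ h
  -- The remaining word is over the base group, which embeds in the extension; its value there is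
  -- `1`, and a single deletion finishes.
  have hw : w.map Sum.inl ∈ rules φ σ none := by
    refine ⟨w, of_injective φ ?_, rfl⟩
    rw [map_one, ← prod_map_value_inl, ← h]
    simp [flatten]
  rw [flatten, List.flatMap_nil, List.append_nil] at hu
  exact hu.trans (MonadicReduces.rule hw)

theorem closure_range_value (hσ : Submonoid.closure (Set.range σ) = ⊤) :
    Submonoid.closure (Set.range (value φ σ)) = ⊤ := by
  rw [eq_top_iff]
  have hof : ∀ g, (of g : HNNExtension G A B φ) ∈ Submonoid.closure (Set.range (value φ σ)) := by
    have : (⊤ : Submonoid G).map (of : G →* HNNExtension G A B φ) ≤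
        Submonoid.closure (Set.range (value φ σ)) := by
      rw [← hσ, MonoidHom.map_mclosure]
      refine Submonoid.closure_mono ?_
      rintro _ ⟨_, ⟨d, rfl⟩, rfl⟩
      exact ⟨Sum.inl (Sum.inl d), rfl⟩
    exact fun g => this ⟨g, trivial, rfl⟩
  have ht : ∀ u : ℤˣ, (t ^ (u : ℤ) : HNNExtension G A B φ) ∈
      Submonoid.closure (Set.range (value φ σ)) :=
    fun u => Submonoid.subset_closure ⟨Sum.inr u, rfl⟩
  -- The closure is that of a submonoid, so inverses are carried through the induction.
  have key : ∀ x : HNNExtension G A B φ, x ∈ Submonoid.closure (Set.range (value φ σ)) ∧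
      x⁻¹ ∈ Submonoid.closure (Set.range (value φ σ)) := by
    intro x
    induction x using HNNExtension.induction_on with
    | of g => exact ⟨hof g, by rw [← map_inv]; exact hof _⟩
    | t => exact ⟨by simpa using ht 1, by simpa using ht (-1)⟩
    | mul x y hx hy => exact ⟨mul_mem hx.1 hy.1, by rw [mul_inv_rev]; exact mul_mem hy.2 hx.2⟩
    | inv x hx => exact ⟨hx.2, by rw [inv_inv]; exact hx.1⟩
  exact fun x _ => (key x).1

end Rewriting

end HNNExtension

/-- Finiteness of the associated subgroups keeps the alphabet finite. The left-hand language of each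
of their letters is a two-sided translate of one fibre of the evaluation in `G`. -/
theorem HasWordProblemIn.hnnExtension {S : Type u₁} [Infinite S] {C : LanguageClass S}
    (hinv : C.ClosedUnderInverseMorphism) (hleft : C.ClosedUnderLeftTranslation)
    (hright : C.ClosedUnderRightTranslation) (hanc : C.ClosedUnderAncestorsOfEmptyWord)
    {G : Type*} [Group G] (h : HasWordProblemIn C G) (A B : Subgroup G) [Finite A] [Finite B]
    (φ : A ≃* B) : HasWordProblemIn C (HNNExtension G A B φ) := by
  obtain ⟨n, σ, hσ⟩ := h.fg.exists_submonoid_closure_eq_top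
  have hfin : ∀ u, Finite (HNNExtension.toSubgroup A B u) := by
    intro u
    rcases Int.units_eq_one_or u with rfl | rfl
    · exact ‹Finite A›
    · exact ‹Finite B›
  refine HasWordProblemIn.of_contains (HNNExtension.Rewriting.closure_range_value φ σ hσ) ?_
  simp only [← HNNExtension.Rewriting.reduces_nil_iff]
  refine LanguageClass.contains_ancestors hinv hanc _ ?_
  have hempty : C.Contains (∅ : Set (List (HNNExtension.Letter (Fin n) A B))) :=
    (h.contains hinv σ).empty hinv hleft
  rintro (_ | (_ | ⟨u, a⟩) | _)
  · exact (h.contains hinv _).map hinv Function.Embedding.inl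
  · exact hempty
  · exact (((h.contains_fiber hinv hleft _ _).map hinv
      Function.Embedding.inl).append_left hleft _).append_right hright _
  · exact hempty

/-! ## Iterated HNN extensions -/

/-- Stable letters are adjoined one by one. The morphism `g` is carried along because it later
provides the retraction onto `Y.F`. -/
theorem exists_iterated_hnnExtension {S : Type u₁} [Infinite S] {C : LanguageClass S}
    (hinv : C.ClosedUnderInverseMorphism) (hleft : C.ClosedUnderLeftTranslation)
    (hright : C.ClosedUnderRightTranslation) (hanc : C.ClosedUnderAncestorsOfEmptyWord)
    {H : Type u₂} [Group H] {I : Type*} {P : I → Type*} [∀ i, Group (P i)] [∀ i, Finite (P i)]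
    (a b : ∀ i, P i →* H) (ha : ∀ i, Function.Injective (a i))
    (hb : ∀ i, Function.Injective (b i)) {L : Type*} [Group L] (f : H →* L) (x : I → L)
    (hx : ∀ i p, x i * f (b i p) = f (a i p) * x i) (s : Finset I) :
    ∃ (K : Type u₂) (_ : Group K) (j : H →* K) (t : I → K) (g : K →* L),
      Function.Injective j ∧ (HasWordProblemIn C H → HasWordProblemIn C K) ∧
      (∀ i ∈ s, ∀ p, t i * j (b i p) = j (a i p) * t i) ∧ (∀ h, g (j h) = f h) ∧
      ∀ i ∈ s, g (t i) = x i := by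
  classical
  induction s using Finset.induction_on with
  | empty =>
    exact ⟨H, inferInstance, MonoidHom.id H, fun _ => 1, f, Function.injective_id, id,
      by simp, fun _ => rfl, by simp⟩
  | insert i s hi ih =>
    obtain ⟨K, _, j, t, g, hj, hC, ht, hg, hgt⟩ := ih
    have hbi : Function.Injective (j.comp (b i)) := hj.comp (hb i)
    have hai : Function.Injective (j.comp (a i)) := hj.comp (ha i)
    -- The stable letter conjugates the image of `b i` to that of `a i`; injectivity of `j` makes
    -- both images copies of `P i` inside `K`.
    let φ : (j.comp (b i)).range ≃* (j.comp (a i)).range :=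
      (MonoidHom.ofInjective hbi).symm.trans (MonoidHom.ofInjective hai)
    have hφ : ∀ p, φ (MonoidHom.ofInjective hbi p) = MonoidHom.ofInjective hai p := by
      intro p
      simp [φ]
    have hfin : ∀ c : P i →* K, Finite c.range :=
      fun c => Set.finite_range c
    have hB := hfin (j.comp (b i))
    have hA := hfin (j.comp (a i))
    refine ⟨HNNExtension K _ _ φ, inferInstance, HNNExtension.of.comp j,
      fun k => if k = i then HNNExtension.t else HNNExtension.of (t k),
      HNNExtension.lift g (x i) ?_, (HNNExtension.of_injective φ).comp hj,
      fun h => (hC h).hnnExtension hinv hleft hright hanc _ _ φ, ?_, ?_, ?_⟩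
    · intro c
      obtain ⟨p, rfl⟩ := (MonoidHom.ofInjective hbi).surjective c
      rw [hφ]
      change x i * g (j (b i p)) = g (j (a i p)) * x i
      rw [hg, hg, hx]
    · intro k hk p
      by_cases hki : k = i
      · subst hki
        have := HNNExtension.t_mul_of (φ := φ) (MonoidHom.ofInjective hbi p)
        rw [hφ] at this
        simp only [if_true]
        exact this
      · have := ht k ((Finset.mem_insert.1 hk).resolve_left hki) p
        simp only [hki, if_false, MonoidHom.comp_apply, ← map_mul, this]
    · intro h
      simp [hg]
    · intro k hk
      by_cases hki : k = i
      · subst hki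
        simp
      · simpa [hki] using hgt k ((Finset.mem_insert.1 hk).resolve_left hki)

/-! ## Graphs of groups -/

namespace GraphOfGroups

variable {V : Type u₁} {E : Type u₂} (Y : GraphOfGroups.{u₁, u₂, u₃, u₄} V E)

/-- The canonical morphism from a vertex group to `F(G, Y)`. -/
def vertexHom (v : V) : Y.vertexGroup v →* Y.F :=
  MonoidHom.mk' (fun g => PresentedGroup.of (Y.vertexLetter g)) fun g h => of_vertexLetter_mul g h

theorem edgeLetter_mul_ω (y : E) (g : Y.edgeGroup y) :
    (PresentedGroup.of (Y.edgeLetter y) : Y.F) * Y.vertexHom _ (Y.ω y g) =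
      Y.vertexHom _ (Y.α y g) * PresentedGroup.of (Y.edgeLetter y) := by
  have := PresentedGroup.one_of_mem (rels := {r : FreeGroup Y.Gen | Y.Rel r}) (Rel.edge y g)
  rw [map_mul, map_inv, mul_inv_eq_one, map_mul, map_mul] at this
  change PresentedGroup.of _ * PresentedGroup.of _ * PresentedGroup.of _ =
    PresentedGroup.of _ at this
  rw [of_edgeLetter_inv, mul_inv_eq_iff_eq_mul] at this
  exact this

/-- In a numbering of the edges, the smaller member of each pair `y`, `Y.inv y` is selected; ties
are excluded by `Y.inv_ne`. -/
theorem exists_orientation [Finite E] : ∃ O : Set E, ∀ y, Y.inv y ∈ O ↔ y ∉ O := by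
  obtain ⟨n, ⟨e⟩⟩ := Finite.exists_equiv_fin E
  refine ⟨{y | e y < e (Y.inv y)}, fun y => ?_⟩
  have : e (Y.inv y) ≠ e y := fun h => Y.inv_ne y (e.injective h)
  simp only [Set.mem_ofPred_eq, Y.inv_inv, not_lt]
  exact ⟨le_of_lt, fun h => lt_of_le_of_ne h this⟩

/-- `F(G, Y)` embeds in an iterated HNN extension of the free product of the vertex groups. -/
theorem exists_embedding [Finite E] [∀ y, Finite (Y.edgeGroup y)] {S : Type*} [Infinite S]
    {C : LanguageClass S} (hinv : C.ClosedUnderInverseMorphism)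
    (hleft : C.ClosedUnderLeftTranslation) (hright : C.ClosedUnderRightTranslation)
    (hanc : C.ClosedUnderAncestorsOfEmptyWord) :
    ∃ (K : Type (max u₁ u₃)) (_ : Group K) (h : Y.F →* K), Function.Injective h ∧
      (∀ v, Function.Injective (h.comp (Y.vertexHom v))) ∧
      (HasWordProblemIn C (Monoid.CoprodI Y.vertexGroup) → HasWordProblemIn C K) := by
  classical
  cases nonempty_fintype E
  obtain ⟨O, hO⟩ := Y.exists_orientation
  -- Both `y` and `Y.inv y` receive a stable letter. The surplus letters do no harm, since `Y.F`
  -- only has to be a retract of `K`.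
  obtain ⟨K, _, j, t, g, hj, hC, ht, hg, hgt⟩ :=
    exists_iterated_hnnExtension hinv hleft hright hanc
    (fun y => Monoid.CoprodI.of.comp (Y.α y)) (fun y => Monoid.CoprodI.of.comp (Y.ω y))
    (fun y => (Monoid.CoprodI.of_injective _).comp (Y.α_injective y))
    (fun y => (Monoid.CoprodI.of_injective _).comp (Y.ω_injective y))
    (Monoid.CoprodI.lift Y.vertexHom) (fun y => (PresentedGroup.of (Y.edgeLetter y) : Y.F))
    (fun y p => by
      simpa using Y.edgeLetter_mul_ω y p)
    (Finset.univ : Finset E)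
  let c : (Σ v, Y.vertexGroup v) → K := fun p => j (Monoid.CoprodI.of p.2)
  have hc : ∀ (v : V) (p q : Y.vertexGroup v), c ⟨v, p * q⟩ = c ⟨v, p⟩ * c ⟨v, q⟩ := by
    intro v p q
    simp [c]
  -- Only the stable letters of `O` are used, which makes the relation `y ȳ = 1` hold.
  let T : E → K := fun y => if y ∈ O then t y else (t (Y.inv y))⁻¹
  have hTinv : ∀ y, T (Y.inv y) = (T y)⁻¹ := by
    intro y
    by_cases hy : y ∈ O
    · have : Y.inv y ∉ O := fun h => (hO y).1 h hy
      simp [T, hy, this, Y.inv_inv]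
    · simp [T, hy, (hO y).2 hy]
  have hT : ∀ y ∈ O, ∀ p : Y.edgeGroup y,
      T y * c ⟨_, Y.ω y p⟩ = c ⟨_, Y.α y p⟩ * T y := by
    intro y hy p
    simp only [T, hy, if_true]
    exact ht y (Finset.mem_univ y) p
  have hT' : ∀ y, ∀ p : Y.edgeGroup y, T y * c ⟨_, Y.ω y p⟩ = c ⟨_, Y.α y p⟩ * T y := by
    intro y p
    by_cases hy : y ∈ O
    · exact hT y hy p
    · have h := hT (Y.inv y) ((hO y).2 hy) (Y.edgeEquiv y p)
      rw [Y.ω_inv, hTinv, eq_mul_inv_iff_mul_eq, mul_assoc, inv_mul_eq_iff_eq_mul] at h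
      exact h.symm
  have hrel : ∀ r ∈ {r : FreeGroup Y.Gen | Y.Rel r}, FreeGroup.lift (Sum.elim c T) r = 1 := by
    rintro _ (⟨v, p, q⟩ | ⟨y⟩ | ⟨y, p⟩)
    · simp [vertexLetter, hc]
    · simp [edgeLetter, hTinv]
    · simp [edgeLetter, vertexLetter, hTinv, hT']
  let h : Y.F →* K := PresentedGroup.toGroup hrel
  have hof : ∀ b, h (PresentedGroup.of b) = Sum.elim c T b := fun b => PresentedGroup.toGroup.of hrel
  -- The retraction, checked on generators; it gives injectivity of `h` without any normal form in
  -- `Y.F`.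
  have hgh : g.comp h = MonoidHom.id Y.F := by
    refine PresentedGroup.ext ?_
    rintro (⟨v, p⟩ | y)
    · rw [MonoidHom.comp_apply, hof]
      simp only [Sum.elim_inl, c, hg, Monoid.CoprodI.lift_of]
      rfl
    · rw [MonoidHom.comp_apply, hof, Sum.elim_inr]
      by_cases hy : y ∈ O
      · simp only [T, hy, if_true, hgt y (Finset.mem_univ y)]
        rfl
      · simp only [T, hy, if_false, map_inv, hgt (Y.inv y) (Finset.mem_univ _)]
        rw [of_edgeLetter_inv, _root_.inv_inv]
        rfl
  refine ⟨K, inferInstance, h, ?_, fun v => ?_, hC⟩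
  · exact Function.LeftInverse.injective (g := g) fun z => DFunLike.congr_fun hgh z
  · have : h.comp (Y.vertexHom v) = j.comp Monoid.CoprodI.of := by
      ext p
      exact hof _
    rw [this]
    exact hj.comp (Monoid.CoprodI.of_injective v)

/-! ### Conjugated vertex groups and finite generation of the fundamental group -/

variable {Y}

theorem eval_mul_eval_mul_inv_mem {v₀ u v : V} {p w q : List Y.Gen} (hp : Y.IsPathWord v₀ u p)
    (hw : Y.IsPathWord u v w) (hq : Y.IsPathWord v₀ v q) :
    Y.eval p * Y.eval w * (Y.eval q)⁻¹ ∈ Y.fundamentalGroup v₀ := by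
  obtain ⟨q', hq', he⟩ := hq.exists_inv
  exact ⟨p ++ w ++ q', (hp.append hw).append hq', by rw [eval_append, eval_append, he]⟩

theorem eval_vertexLetter {v : V} (g : Y.vertexGroup v) :
    Y.eval [Y.vertexLetter g] = Y.vertexHom v g := by
  simp [eval, vertexHom]

theorem IsPathWord.singleton_vertex {v : V} (g : Y.vertexGroup v) :
    Y.IsPathWord v v [Y.vertexLetter g] :=
  IsPathWord.vertex g (IsPathWord.nil v)

theorem IsPathWord.singleton_edge (y : E) :
    Y.IsPathWord (Y.src y) (Y.tgt y) [Y.edgeLetter y] :=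
  IsPathWord.edge y (IsPathWord.nil _)

variable (Y)

/-- The conjugate of the canonical morphism of a vertex group by an element of `F(G, Y)`. -/
def conjVertexHom (v : V) (x : Y.F) : Y.vertexGroup v →* Y.F :=
  (MulAut.conj x).toMonoidHom.comp (Y.vertexHom v)

theorem conjVertexHom_apply (v : V) (x : Y.F) (g : Y.vertexGroup v) :
    Y.conjVertexHom v x g = x * Y.vertexHom v g * x⁻¹ := rfl

variable {Y} in
theorem conjVertexHom_mem {v₀ v : V} {p : List Y.Gen} (hp : Y.IsPathWord v₀ v p)
    (g : Y.vertexGroup v) : Y.conjVertexHom v (Y.eval p) g ∈ Y.fundamentalGroup v₀ := by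
  rw [conjVertexHom_apply, ← eval_vertexLetter]
  exact eval_mul_eval_mul_inv_mem hp (IsPathWord.singleton_vertex g) hp

variable {Y} in
theorem exists_isPathWord_of_reflTransGen {u v : V}
    (h : Relation.ReflTransGen (fun a b => ∃ y, Y.src y = a ∧ Y.tgt y = b) u v) :
    ∃ p, Y.IsPathWord u v p := by
  induction h with
  | refl => exact ⟨[], IsPathWord.nil _⟩
  | tail _ h ih =>
    obtain ⟨p, hp⟩ := ih
    obtain ⟨y, rfl, rfl⟩ := h
    exact ⟨_, hp.append (IsPathWord.singleton_edge y)⟩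

/-- Fix a path word `p v` from `v₀` to each reachable vertex `v`. Inserting `(p v)⁻¹ (p v)` at the
vertices along a path writes its value, up to the two ends, as a product of elements of conjugated
vertex groups and of elements `p (src y) y (p (tgt y))⁻¹`, finitely many of the latter. -/
theorem fundamentalGroup_fg [Finite V] [Finite E] (hfg : ∀ v, Group.FG (Y.vertexGroup v))
    (v₀ : V) : Group.FG (Y.fundamentalGroup v₀) := by
  rw [Group.fg_iff_subgroup_fg]
  choose p hp using fun v : {v // ∃ p, Y.IsPathWord v₀ v p} => v.2
  have step : ∀ y : {y // ∃ p, Y.IsPathWord v₀ (Y.src y) p},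
      ∃ p, Y.IsPathWord v₀ (Y.tgt y) p := fun y =>
    ⟨_, y.2.choose_spec.append (IsPathWord.singleton_edge _)⟩
  let o : {v // ∃ p, Y.IsPathWord v₀ v p} := ⟨v₀, [], IsPathWord.nil v₀⟩
  let edgeElt : {y // ∃ p, Y.IsPathWord v₀ (Y.src y) p} → Y.F := fun y =>
    Y.eval (p ⟨_, y.2⟩) * Y.eval [Y.edgeLetter y] * (Y.eval (p ⟨_, step y⟩))⁻¹
  obtain ⟨M₁, hM₁⟩ : ∃ M₁, M₁ = ⨆ v, (Y.conjVertexHom v.1 (Y.eval (p v))).range := ⟨_, rfl⟩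
  -- The path word chosen for `v₀` itself may have a nontrivial value, which is added to the
  -- generators so that the ends can be removed.
  obtain ⟨M₂, hM₂⟩ : ∃ M₂, M₂ = Subgroup.closure (insert (Y.eval (p o)) (Set.range edgeElt)) :=
    ⟨_, rfl⟩
  have hFG₁ : M₁.FG := by
    rw [hM₁]
    refine Subgroup.FG.iSup _ fun v => ?_
    have := hfg v.1
    rw [← Group.fg_iff_subgroup_fg]
    exact Group.fg_range _
  have hFG₂ : M₂.FG := (Subgroup.fg_iff _).2 ⟨_, hM₂.symm, (Set.finite_range _).insert _⟩
  obtain ⟨M, hMdef⟩ : ∃ M, M = M₁ ⊔ M₂ := ⟨_, rfl⟩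
  have hM : M.FG := hMdef ▸ hFG₁.sup hFG₂
  have hle₁ : ∀ v, (Y.conjVertexHom v.1 (Y.eval (p v))).range ≤ M := fun v => by
    rw [hMdef, hM₁]
    exact le_sup_of_le_left (le_iSup (fun v => (Y.conjVertexHom v.1 (Y.eval (p v))).range) v)
  have hle₂ : insert (Y.eval (p o)) (Set.range edgeElt) ⊆ (M : Set Y.F) := by
    rw [← Subgroup.closure_le, ← hM₂, hMdef]
    exact le_sup_right
  have hvM : ∀ v g, Y.conjVertexHom v.1 (Y.eval (p v)) g ∈ M := fun v g => hle₁ v ⟨g, rfl⟩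
  have heM : ∀ y, edgeElt y ∈ M := fun y => hle₂ (Set.mem_insert_of_mem _ ⟨y, rfl⟩)
  have hoM : Y.eval (p o) ∈ M := hle₂ (Set.mem_insert _ _)
  have key : ∀ {u v : V} {w : List Y.Gen}, Y.IsPathWord u v w →
      ∀ (hu : ∃ p, Y.IsPathWord v₀ u p) (hv : ∃ p, Y.IsPathWord v₀ v p),
      Y.eval (p ⟨u, hu⟩) * Y.eval w * (Y.eval (p ⟨v, hv⟩))⁻¹ ∈ M := by
    intro u v w hw
    induction hw with
    | nil v =>
      intro _ _
      simp [eval, one_mem]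
    | @vertex u v g w _ ih =>
      intro hu hv
      have := mul_mem (hvM ⟨u, hu⟩ g) (ih hu hv)
      rw [conjVertexHom_apply, ← eval_vertexLetter] at this
      rw [← List.singleton_append, eval_append]
      simpa [mul_assoc] using this
    | @edge y v w _ ih =>
      intro hu hv
      have := mul_mem (heM ⟨y, hu⟩) (ih (step ⟨y, hu⟩) hv)
      rw [← List.singleton_append, eval_append]
      simpa [edgeElt, mul_assoc] using this
  have hMeq : M = Y.fundamentalGroup v₀ := by
    refine le_antisymm ?_ ?_
    · rw [hMdef, hM₁, hM₂]
      refine sup_le (iSup_le fun v => ?_) ((Subgroup.closure_le _).2 ?_)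
      · rintro _ ⟨g, rfl⟩
        exact conjVertexHom_mem (hp v) g
      · rintro _ (rfl | ⟨y, rfl⟩)
        · exact ⟨_, hp o, rfl⟩
        · exact eval_mul_eval_mul_inv_mem (hp _) (IsPathWord.singleton_edge _) (hp ⟨_, step y⟩)
    · rintro _ ⟨w, hw, rfl⟩
      have h := mul_mem (mul_mem (inv_mem hoM) (key hw o.2 o.2)) hoM
      have ho : Y.eval (p ⟨v₀, o.2⟩) = Y.eval (p o) := rfl
      simpa [ho, mul_assoc] using h
  rwa [← hMeq]

end GraphOfGroups

/-! ### The theorem on fundamental groups of graphs of groups -/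

theorem mainTheorem12 {S : Type u₁} [Infinite S] (C : LanguageClass S)
    (hinv : C.ClosedUnderInverseMorphism)
    (hleft : C.ClosedUnderLeftTranslation)
    (hright : C.ClosedUnderRightTranslation)
    (hanc : C.ClosedUnderAncestorsOfEmptyWord)
    {V : Type*} {E : Type*} [Finite V] [Finite E] (Y : GraphOfGroups V E)
    (hfg : ∀ v : V, Group.FG (Y.vertexGroup v))
    (hfin : ∀ y : E, Finite (Y.edgeGroup y))
    (v₀ : V) :
    ((∀ v : V, HasWordProblemIn C (Y.vertexGroup v)) →
      HasWordProblemIn C (Y.fundamentalGroup v₀)) ∧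
    (C.ClosedUnderRegularIntersection → Y.Connected →
      HasWordProblemIn C (Y.fundamentalGroup v₀) →
      ∀ v : V, HasWordProblemIn C (Y.vertexGroup v)) := by
  obtain ⟨K, _, h, hh, hvertex, hC⟩ := Y.exists_embedding hinv hleft hright hanc
  refine ⟨fun hv => ?_, fun _ hconn hπ v => ?_⟩
  · have : Nonempty V := ⟨v₀⟩
    exact (hC (HasWordProblemIn.coprodI hinv hleft hanc hv)).of_injective hinv
      (Y.fundamentalGroup_fg hfg v₀) (h.comp (Y.fundamentalGroup v₀).subtype)
      (hh.comp (Y.fundamentalGroup v₀).subtype_injective)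
  -- Conjugation by the value of a path word from `v₀` to `v` carries the vertex group injectively
  -- into the fundamental group.
  · obtain ⟨p, hp⟩ := GraphOfGroups.exists_isPathWord_of_reflTransGen (hconn v₀ v)
    refine hπ.of_injective hinv (hfg v) ((Y.conjVertexHom v (Y.eval p)).codRestrict _
      (GraphOfGroups.conjVertexHom_mem hp)) ?_
    have hinj : Function.Injective (Y.vertexHom v) :=
      Function.Injective.of_comp (f := h) (hvertex v)
    intro a b hab
    exact hinj ((MulAut.conj (Y.eval p)).injective (congrArg Subtype.val hab))
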